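/- Consider the push-sum algorithm on two nodes with transmission failure probability $p\in[0,1)$. Start from $z_1(0)=(1,0)$, $z_2(0)=(0,1)$. At each step $t=0,1,2,\dots$, independently of the past, choose the sender $i\in\{1,2\}$ uniformly, let $j$ be the other node, and let $\chi_{t+1}$ be independent of that choice with $P(\chi_{t+1}=0)=p$, $P(\chi_{t+1}=1)=1-p$; set $$z_i(t+1)=\tfrac12 z_i(t),\qquad z_j(t+1)=z_j(t)+\tfrac12\chi_{t+1}z_i(t).$$ Then, almost surely, the limit $\tau=(\tau_1,\tau_2)=\lim_{t\to\infty} z_i(t)/\|z_i(t)\|_1$ exists and is the same for $i=1,2$, and the expected square error $$R=E\Big(2\sum_{i=1}^2\big(\tau_i-\tfrac12\big)^2\Big)$$ satisfies $$R\le \frac{p(1-p)^2}{3+p}+\frac{p}{25(1+p^2)}\left(18+23p+50p^2-41p^3\right).$$ -/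

import Mathlib

open MeasureTheory ProbabilityTheory Filter Topology

noncomputable section

namespace PushSum

/-- The directed edges `(i, j)`, `i ≠ j`, of the complete graph on `n` nodes: `i` sends to `j`. -/
abbrev Edge (n : ℕ) : Type := {e : Fin n × Fin n // e.1 ≠ e.2}

/-- The randomness driving the push-sum algorithm on `n` nodes with failure probability `p`.
At step `t` an edge `edge t` is chosen uniformly among the `n (n - 1)` directed edges, and,
independently of that choice, the message is delivered (`recv t = true`) with probability `1 - p`
and lost (`recv t = false`) with probability `p`; different steps are independent. -/
structure IsNoise {Ω : Type*} [MeasurableSpace Ω] (n : ℕ) (p : ℝ) (P : Measure Ω)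
    (edge : ℕ → Ω → Edge n) (recv : ℕ → Ω → Bool) : Prop where
  measurable_edge : ∀ t, Measurable (edge t)
  measurable_recv : ∀ t, Measurable (recv t)
  indep : iIndepFun (fun t ω => (edge t ω, recv t ω)) P
  law : ∀ (t : ℕ) (e : Edge n) (b : Bool),
    P.real {ω | edge t ω = e ∧ recv t ω = b} =
      1 / ((n : ℝ) * ((n : ℝ) - 1)) * (if b = true then 1 - p else p)

/-- One step along the edge `e = (i, j)`: the sender `i` keeps one half of its vector; the receiver
`j` gains the other half if the message is delivered and nothing if it is lost; the other nodes are
unchanged. -/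
def step {n : ℕ} (e : Edge n) (b : Bool) (z : Fin n → Fin n → ℝ) : Fin n → Fin n → ℝ :=
  fun k =>
    if k = e.1.1 then (1 / 2 : ℝ) • z k
    else if k = e.1.2 then z k + (if b = true then (1 / 2 : ℝ) else 0) • z e.1.1
    else z k

/-- The vectors `z_1(t), …, z_n(t)` of the push-sum coefficient algorithm, started from the standard
basis vectors `z_i(0) = e_i`. -/
def state {Ω : Type*} {n : ℕ} (edge : ℕ → Ω → Edge n) (recv : ℕ → Ω → Bool) :
    ℕ → Ω → Fin n → Fin n → ℝ
  | 0, _ => fun i => Pi.single i 1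
  | t + 1, ω => step (edge t ω) (recv t ω) (state edge recv t ω)

/-- The rescaled vector `z_i(t) / ‖z_i(t)‖₁` of node `i`. -/
def ratio {Ω : Type*} {n : ℕ} (edge : ℕ → Ω → Edge n) (recv : ℕ → Ω → Bool)
    (i : Fin n) (t : ℕ) (ω : Ω) : Fin n → ℝ :=
  (∑ j, |state edge recv t ω i j|)⁻¹ • state edge recv t ω i

/-- The push-sum coefficient `τ = lim_t z_1(t) / ‖z_1(t)‖₁`. -/
def coeff {Ω : Type*} {n : ℕ} [NeZero n] (edge : ℕ → Ω → Edge n) (recv : ℕ → Ω → Bool)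
    (ω : Ω) : Fin n → ℝ :=
  limUnder atTop (fun t => ratio edge recv 0 t ω)

/-- The square error `n ∑ᵢ (τᵢ - 1 / n)²` of a coefficient vector `τ`. -/
def sqError {n : ℕ} (τ : Fin n → ℝ) : ℝ :=
  (n : ℝ) * ∑ i, (τ i - 1 / (n : ℝ)) ^ 2

/-- The expected square error `R = E(n ∑ᵢ (τᵢ - 1 / n)²)`. -/
def expectedError {Ω : Type*} [MeasurableSpace Ω] {n : ℕ} [NeZero n] (P : Measure Ω)
    (edge : ℕ → Ω → Edge n) (recv : ℕ → Ω → Bool) : ℝ :=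
  ∫ ω, sqError (coeff edge recv ω) ∂P

end PushSum

end

/-! Convergence: a step leaves the sender's normalized vector fixed and moves the receiver's towards
it, so the gap between the two never grows. A delivered message each way, `edge₀₁` and then
`edge₁₀`, shrinks it by a factor 2/3 (`gap_exchange`). By Borel–Cantelli this happens infinitely
often almost surely (`IsNoise.frequently_exchange`), and both nodes share one limit.

Error: for two nodes the square error of a normalized vector is the square of its bias u. The states
are products of random matrices, so the first step can be peeled off on the right
(`run_succ_eq_act`): it acts on a row built from the later, independent steps. Averaging over its
four outcomes gives E u'² ≤ (5/9 + p/3) u² + p/9. Iterating and letting t → ∞ bounds R by the fixed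
point p/(4 - 3p), which is smaller than the claimed bound (`fixed_point_le`). -/

namespace PushSum

/-! ### Deterministic dynamics and the first-step decomposition -/

/-- The states along a fixed sequence of edges and receipts. -/
noncomputable def run {n : ℕ} (x : ℕ → Edge n × Bool) : ℕ → Fin n → Fin n → ℝ
  | 0 => fun i => Pi.single i 1
  | t + 1 => step (x t).1 (x t).2 (run x t)

theorem state_eq_run {Ω : Type*} {n : ℕ} (edge : ℕ → Ω → Edge n) (recv : ℕ → Ω → Bool)
    (t : ℕ) (ω : Ω) :
    state edge recv t ω = run (fun s => (edge s ω, recv s ω)) t := by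
  induction t with
  | zero => rfl
  | succ t ih => simp only [state, run, ih]

theorem run_congr {n : ℕ} {x y : ℕ → Edge n × Bool} {t : ℕ} (h : ∀ s < t, x s = y s) :
    run x t = run y t := by
  induction t with
  | zero => rfl
  | succ t ih => simp only [run, h t t.lt_succ_self, ih fun s hs => h s (hs.trans t.lt_succ_self)]

/-- The action of the transition matrix of one step on row vectors. -/
noncomputable def act {n : ℕ} (c : Edge n × Bool) (r : Fin n → ℝ) : Fin n → ℝ :=
  fun k => if k = c.1.1.1 then 1 / 2 * r k + (if c.2 = true then 1 / 2 else 0) * r c.1.1.2 else r k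

/-- Left and right multiplication by matrices commute: `step` combines rows, `act` combines columns.
-/
theorem act_step {n : ℕ} (c : Edge n × Bool) (e : Edge n) (b : Bool) (z : Fin n → Fin n → ℝ)
    (i : Fin n) : act c (step e b z i) = step e b (fun k => act c (z k)) i := by
  ext k
  simp only [act, step, ite_apply, Pi.add_apply, Pi.smul_apply, smul_eq_mul]
  split_ifs <;> ring

theorem step_single {n : ℕ} (c : Edge n × Bool) (i : Fin n) :
    step c.1 c.2 (fun k => Pi.single k (1 : ℝ)) i = act c (Pi.single i 1) := by
  obtain ⟨⟨⟨a, a'⟩, h⟩, b⟩ := c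
  change a ≠ a' at h
  ext k
  rcases eq_or_ne i a with rfl | hi
  · simp [act, step, Pi.single_apply, h.symm]
    intros; simp_all
  rcases eq_or_ne i a' with rfl | hi'
  · rcases eq_or_ne k a with rfl | hk
    · cases b <;> simp [act, step, hi, h]
    · cases b <;> simp [act, step, hi, hk]
  · rcases eq_or_ne k a with rfl | hk
    · simp [act, step, hi, hi', hi.symm, hi'.symm]
    · simp [act, step, hi, hi', hk]

/-- Conditioning on the first step: the states are read off the shifted sequence. -/
theorem run_succ_eq_act {n : ℕ} (x : ℕ → Edge n × Bool) (t : ℕ) (i : Fin n) :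
    run x (t + 1) i = act (x 0) (run (fun s => x (s + 1)) t i) := by
  induction t generalizing i with
  | zero => exact step_single _ _
  | succ t ih =>
    rw [run, show run x (t + 1) = fun k => act (x 0) (run (fun s => x (s + 1)) t k) from
      funext ih, ← act_step]
    rfl

/-- The edge from the first node to the second. -/
def edge₀₁ : Edge 2 := ⟨(0, 1), by decide⟩

/-- The edge from the second node to the first. -/
def edge₁₀ : Edge 2 := ⟨(1, 0), by decide⟩

theorem edge_cases (e : Edge 2) : e = edge₀₁ ∨ e = edge₁₀ := by
  revert e; decide

theorem univ_edge : (Finset.univ : Finset (Edge 2)) = {edge₀₁, edge₁₀} := by decide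

/-! ### Contraction of the gap and consensus -/

/-- A pair of nonnegative vectors, none of which vanishes. -/
structure Pos (z : Fin 2 → Fin 2 → ℝ) : Prop where
  nonneg : ∀ i j, 0 ≤ z i j
  pos : ∀ i, 0 < z i 0 + z i 1

theorem Pos.step {z : Fin 2 → Fin 2 → ℝ} (hz : Pos z) (e : Edge 2) (b : Bool) :
    Pos (step e b z) := by
  have h := hz.nonneg
  have h0 := hz.pos 0
  have h1 := hz.pos 1
  have h00 := h 0 0
  have h01 := h 0 1
  have h10 := h 1 0
  have h11 := h 1 1
  rcases edge_cases e with rfl | rfl <;> cases b <;> refine ⟨fun i j => ?_, fun i => ?_⟩ <;>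
    fin_cases i <;> (try fin_cases j) <;> simp [PushSum.step, edge₀₁, edge₁₀] <;> linarith

theorem pos_run (x : ℕ → Edge 2 × Bool) (t : ℕ) : Pos (run x t) := by
  induction t with
  | zero =>
    refine ⟨fun i j => ?_, fun i => ?_⟩
    · simp only [run, Pi.single_apply]; split_ifs <;> norm_num
    · fin_cases i <;> simp [run]
  | succ t ih => exact ih.step _ _

/-- The total weight of node `i`. -/
def mass (z : Fin 2 → Fin 2 → ℝ) (i : Fin 2) : ℝ := z i 0 + z i 1

/-- The first coordinate of the rescaled vector of node `i`. -/
noncomputable def share (z : Fin 2 → Fin 2 → ℝ) (i : Fin 2) : ℝ := z i 0 / (z i 0 + z i 1)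

/-- The distance between the rescaled vectors of the two nodes. -/
noncomputable def gap (z : Fin 2 → Fin 2 → ℝ) : ℝ := |share z 0 - share z 1|

theorem share_step_sender {z : Fin 2 → Fin 2 → ℝ} (e : Edge 2) (b : Bool) :
    share (step e b z) e.1.1 = share z e.1.1 := by
  simp only [share, step, if_true, Pi.smul_apply, smul_eq_mul]
  rw [← mul_add, mul_div_mul_left _ _ (by norm_num)]

/-- The rescaled vector of the receiver moves towards the one of the sender. -/
theorem share_step_receiver {z : Fin 2 → Fin 2 → ℝ} (hz : Pos z) (e : Edge 2) (b : Bool) :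
    ∃ θ : ℝ, 0 ≤ θ ∧ θ ≤ 1 ∧
      share (step e b z) e.1.2 = share z e.1.2 + θ * (share z e.1.1 - share z e.1.2) ∧
      (b = true → mass z e.1.2 ≤ mass z e.1.1 → 1 / 3 ≤ θ) := by
  have hi := hz.pos e.1.1
  have hj := hz.pos e.1.2
  have hne : e.1.2 ≠ e.1.1 := e.2.symm
  set β : ℝ := if b = true then 1 / 2 else 0 with hβ
  have hβ0 : 0 ≤ β := by rw [hβ]; split_ifs <;> norm_num
  simp only [share, step, if_neg hne, if_true, Pi.add_apply, Pi.smul_apply, smul_eq_mul, mass]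
  rw [← hβ]
  generalize z e.1.1 0 = a at *
  generalize z e.1.1 1 = a' at *
  generalize z e.1.2 0 = c at *
  generalize z e.1.2 1 = c' at *
  have hden : 0 < c + β * a + (c' + β * a') := by nlinarith [mul_nonneg hβ0 hi.le]
  -- θ is the fraction of the receiver's new mass that has just arrived.
  refine ⟨β * (a + a') / (c + β * a + (c' + β * a')), by positivity, ?_, ?_, ?_⟩
  · rw [div_le_one hden]; nlinarith
  · field_simp
    ring
  · rintro rfl h
    simp only [if_true] at hβ
    rw [le_div_iff₀ hden, hβ]
    linarith

theorem gap_step {z : Fin 2 → Fin 2 → ℝ} (hz : Pos z) (e : Edge 2) (b : Bool) :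
    gap (step e b z) ≤ gap z ∧
      min (share z 0) (share z 1) ≤ min (share (step e b z) 0) (share (step e b z) 1) ∧
      (b = true → mass z e.1.2 ≤ mass z e.1.1 → gap (step e b z) ≤ 2 / 3 * gap z) := by
  obtain ⟨θ, h0, h1, hj, hθ⟩ := share_step_receiver hz e b
  have hi := share_step_sender (z := z) e b
  have hgap : gap (step e b z) = (1 - θ) * gap z := by
    rw [← abs_of_nonneg (sub_nonneg.2 h1), gap, gap, ← abs_mul]
    rcases edge_cases e with rfl | rfl <;> simp only [edge₀₁, edge₁₀] at hi hj ⊢ <;> rw [hi, hj]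
    · congr 1; ring
    · congr 1; ring
  have hg : 0 ≤ gap z := abs_nonneg _
  refine ⟨by rw [hgap]; nlinarith, ?_, fun hb hm => by rw [hgap]; nlinarith [hθ hb hm]⟩
  rcases edge_cases e with rfl | rfl <;> simp only [edge₀₁, edge₁₀] at hi hj ⊢ <;> rw [hi, hj] <;>
    refine le_min ?_ ?_
  · exact min_le_left _ _
  · have := min_le_left (share z 0) (share z 1)
    have := min_le_right (share z 0) (share z 1)
    nlinarith
  · have := min_le_left (share z 0) (share z 1)
    have := min_le_right (share z 0) (share z 1)
    nlinarith
  · exact min_le_right _ _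

/-- After the first delivery node 1 has at least the mass of node 0, which has halved, so the reply
satisfies the mass condition in `gap_step` whatever the initial masses. -/
theorem gap_exchange {z : Fin 2 → Fin 2 → ℝ} (hz : Pos z) :
    gap (step edge₁₀ true (step edge₀₁ true z)) ≤ 2 / 3 * gap z := by
  have h := hz.pos 1
  refine ((gap_step (hz.step edge₀₁ true) edge₁₀ true).2.2 rfl ?_).trans ?_
  · simp [mass, step, edge₀₁, edge₁₀]
    linarith
  · linarith [(gap_step hz edge₀₁ true).1]

theorem share_mem {z : Fin 2 → Fin 2 → ℝ} (hz : Pos z) (i : Fin 2) :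
    0 ≤ share z i ∧ share z i ≤ 1 :=
  ⟨div_nonneg (hz.nonneg i 0) (hz.pos i).le,
    (div_le_one (hz.pos i)).2 (by linarith [hz.nonneg i 1])⟩

/-- If the two nodes successfully exchange messages infinitely often, their shares agree in the
limit. -/
theorem exists_tendsto_share (x : ℕ → Edge 2 × Bool)
    (hx : ∃ᶠ t in atTop, x t = (edge₀₁, true) ∧ x (t + 1) = (edge₁₀, true)) :
    ∃ l, ∀ i, Tendsto (fun t => share (run x t) i) atTop (𝓝 l) := by
  have hstep := fun t => gap_step (pos_run x t) (x t).1 (x t).2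
  have hanti : Antitone fun t => gap (run x t) := antitone_nat_of_succ_le fun t => (hstep t).1
  have hmono : Monotone fun t => min (share (run x t) 0) (share (run x t) 1) :=
    monotone_nat_of_le_succ fun t => (hstep t).2.1
  have hg := tendsto_atTop_ciInf hanti
    ⟨0, by rintro _ ⟨t, rfl⟩; exact abs_nonneg _⟩
  have hm := tendsto_atTop_ciSup hmono
    ⟨1, by rintro _ ⟨t, rfl⟩; exact (min_le_left _ _).trans (share_mem (pos_run x t) 0).2⟩
  set L := ⨅ t, gap (run x t)
  set m := ⨆ t, min (share (run x t) 0) (share (run x t) 1)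
  have hL : L = 0 := by
    have h0 : 0 ≤ L := ge_of_tendsto' hg fun t => abs_nonneg _
    -- The contraction need only hold at infinitely many times to pass to the limit.
    have h1 : L ≤ 2 / 3 * L := by
      refine le_of_tendsto_of_tendsto_of_frequently ((tendsto_add_atTop_iff_nat 2).2 hg)
        (hg.const_mul _) (hx.mono ?_)
      rintro t ⟨h1, h2⟩
      change gap (step (x (t + 1)).1 (x (t + 1)).2 (step (x t).1 (x t).2 (run x t))) ≤ _
      rw [h1, h2]
      exact gap_exchange (pos_run x t)
    linarith
  rw [hL] at hg
  refine ⟨m, fun i => ?_⟩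
  -- Each share lies between the minimum and the minimum plus the gap.
  refine tendsto_of_tendsto_of_tendsto_of_le_of_le hm (by simpa using hm.add hg)
    (fun t => ?_) fun t => ?_
  · fin_cases i
    · exact min_le_left _ _
    · exact min_le_right _ _
  · simp only [gap]
    have := le_abs_self (share (run x t) 0 - share (run x t) 1)
    have := neg_abs_le (share (run x t) 0 - share (run x t) 1)
    rcases min_choice (share (run x t) 0) (share (run x t) 1) with h | h <;> rw [h] <;>
      fin_cases i <;> simp <;> linarith [abs_nonneg (share (run x t) 0 - share (run x t) 1)]

/-! ### Squared bias and its one-step contraction -/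

/-- The signed relative difference of the entries of a vector. -/
noncomputable def bias (r : Fin 2 → ℝ) : ℝ := (r 0 - r 1) / (r 0 + r 1)

theorem bias_sq_le_one {r : Fin 2 → ℝ} (h0 : 0 ≤ r 0) (h1 : 0 ≤ r 1) : bias r ^ 2 ≤ 1 := by
  rw [bias, div_pow]
  exact div_le_one_of_le₀ (by nlinarith [mul_nonneg h0 h1]) (sq_nonneg _)

theorem ratio_apply {Ω : Type*} (edge : ℕ → Ω → Edge 2) (recv : ℕ → Ω → Bool)
    (i : Fin 2) (t : ℕ) (ω : Ω) :
    ratio edge recv i t ω = ![share (run (fun s => (edge s ω, recv s ω)) t) i,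
      1 - share (run (fun s => (edge s ω, recv s ω)) t) i] := by
  have hz := pos_run (fun s => (edge s ω, recv s ω)) t
  rw [ratio, state_eq_run]
  generalize run (fun s => (edge s ω, recv s ω)) t = z at *
  have h := hz.pos i
  ext j
  fin_cases j <;> simp [share, Fin.sum_univ_two, abs_of_nonneg (hz.nonneg i _)] <;> field_simp
  ring

theorem sqError_ratio {Ω : Type*} (edge : ℕ → Ω → Edge 2) (recv : ℕ → Ω → Bool)
    (i : Fin 2) (t : ℕ) (ω : Ω) :
    sqError (ratio edge recv i t ω) = bias (run (fun s => (edge s ω, recv s ω)) t i) ^ 2 := by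
  have hz := pos_run (fun s => (edge s ω, recv s ω)) t
  rw [ratio_apply]
  generalize run (fun s => (edge s ω, recv s ω)) t = z at *
  have h := hz.pos i
  simp [sqError, bias, share, Fin.sum_univ_two]
  field_simp
  ring

/-- The probability of each outcome of a step. -/
noncomputable def weight (p : ℝ) (c : Edge 2 × Bool) : ℝ := 1 / 2 * (if c.2 = true then 1 - p else p)

/-- One step contracts the expected squared bias, up to an additive term. -/
theorem sum_weight_mul_bias_act_sq_le {p : ℝ} (hp0 : 0 ≤ p) (hp1 : p ≤ 1) {r : Fin 2 → ℝ}
    (h0 : 0 ≤ r 0) (h1 : 0 ≤ r 1) (h : 0 < r 0 + r 1) :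
    ∑ c, weight p c * bias (act c r) ^ 2 ≤ (5 / 9 + p / 3) * bias r ^ 2 + p / 9 := by
  have hv : bias r ^ 2 ≤ 1 := bias_sq_le_one h0 h1
  obtain ⟨hl, hr⟩ := abs_le.1 ((sq_le_one_iff_abs_le_one _).1 hv)
  have e1 : bias (act (edge₀₁, true) r) = bias r / (2 - bias r) := by
    have hA : bias (act (edge₀₁, true) r) = (r 0 - r 1) / (r 0 + 3 * r 1) := by
      rw [bias, ← mul_div_mul_left _ _ (two_ne_zero' ℝ)]
      congr 1 <;> simp [act, edge₀₁] <;> ring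
    rw [hA, show 2 - bias r = (r 0 + 3 * r 1) / (r 0 + r 1) by
      rw [bias]; field_simp; ring, bias, div_div_div_cancel_right₀ h.ne']
  have e2 : bias (act (edge₁₀, true) r) = bias r / (2 + bias r) := by
    have hA : bias (act (edge₁₀, true) r) = (r 0 - r 1) / (3 * r 0 + r 1) := by
      rw [bias, ← mul_div_mul_left _ _ (two_ne_zero' ℝ)]
      congr 1 <;> simp [act, edge₁₀] <;> ring
    rw [hA, show 2 + bias r = (3 * r 0 + r 1) / (r 0 + r 1) by
      rw [bias]; field_simp; ring, bias, div_div_div_cancel_right₀ h.ne']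
  have e3 : bias (act (edge₀₁, false) r) = (3 * bias r - 1) / (3 - bias r) := by
    have hA : bias (act (edge₀₁, false) r) = (2 * r 0 - 4 * r 1) / (2 * r 0 + 4 * r 1) := by
      rw [bias, ← mul_div_mul_left _ _ (four_ne_zero' ℝ)]
      congr 1 <;> simp [act, edge₀₁] <;> ring
    rw [hA, show 3 * bias r - 1 = (2 * r 0 - 4 * r 1) / (r 0 + r 1) by rw [bias]; field_simp; ring,
      show 3 - bias r = (2 * r 0 + 4 * r 1) / (r 0 + r 1) by
        rw [bias]; field_simp; ring, div_div_div_cancel_right₀ h.ne']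
  have e4 : bias (act (edge₁₀, false) r) = (3 * bias r + 1) / (3 + bias r) := by
    have hA : bias (act (edge₁₀, false) r) = (4 * r 0 - 2 * r 1) / (4 * r 0 + 2 * r 1) := by
      rw [bias, ← mul_div_mul_left _ _ (four_ne_zero' ℝ)]
      congr 1 <;> simp [act, edge₁₀] <;> ring
    rw [hA, show 3 * bias r + 1 = (4 * r 0 - 2 * r 1) / (r 0 + r 1) by rw [bias]; field_simp; ring,
      show 3 + bias r = (4 * r 0 + 2 * r 1) / (r 0 + r 1) by
        rw [bias]; field_simp; ring, div_div_div_cancel_right₀ h.ne']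
  rw [Fintype.sum_prod_type, univ_edge, Finset.sum_pair (by decide)]
  simp only [Fintype.sum_bool, weight, e1, e2, e3, e4, if_true, Bool.false_eq_true, if_false]
  generalize bias r = u at *
  -- Here and in `hh`, the right side is the chord in the variable u², agreeing with the left side
  -- at u² = 0 and u² = 1; hence the factors u² and 1 - u² below.
  have hg : (u / (2 - u)) ^ 2 + (u / (2 + u)) ^ 2 ≤ 10 / 9 * u ^ 2 := by
    have ha : 0 < 2 - u := by linarith
    have hb : 0 < 2 + u := by linarith
    rw [div_pow, div_pow, div_add_div _ _ (by positivity) (by positivity),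
      div_le_iff₀ (by positivity), ← sub_nonneg]
    have : 0 ≤ u ^ 2 * (1 - u ^ 2) * (44 - 5 * u ^ 2) * (2 / 9) :=
      mul_nonneg (mul_nonneg (mul_nonneg (sq_nonneg _) (by linarith)) (by linarith)) (by norm_num)
    linarith
  have hh : ((3 * u - 1) / (3 - u)) ^ 2 + ((3 * u + 1) / (3 + u)) ^ 2 ≤ 2 / 9 + 16 / 9 * u ^ 2 := by
    have ha : 0 < 3 - u := by linarith
    have hb : 0 < 3 + u := by linarith
    rw [div_pow, div_pow, div_add_div _ _ (by positivity) (by positivity),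
      div_le_iff₀ (by positivity), ← sub_nonneg]
    have : 0 ≤ u ^ 2 * (1 - u ^ 2) * (27 - u ^ 2) * (16 / 9) :=
      mul_nonneg (mul_nonneg (mul_nonneg (sq_nonneg _) (by linarith)) (by linarith)) (by norm_num)
    linarith
  have := mul_le_mul_of_nonneg_left hg (sub_nonneg.2 hp1)
  have := mul_le_mul_of_nonneg_left hh hp0
  linarith

/-- The fixed point of the contraction lies below the bound of the error. -/
theorem fixed_point_le {p : ℝ} (hp0 : 0 ≤ p) (hp1 : p ≤ 1) :
    p / (4 - 3 * p) ≤ p * (1 - p) ^ 2 / (3 + p)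
        + p / (25 * (1 + p ^ 2)) * (18 + 23 * p + 50 * p ^ 2 - 41 * p ^ 3) := by
  have hq : 0 ≤ 1 - p := by linarith
  have hd : 0 < 4 - 3 * p := by linarith
  have h1 : p / (4 - 3 * p) ≤ p / (25 * (1 + p ^ 2)) * (18 + 23 * p + 50 * p ^ 2 - 41 * p ^ 3) := by
    rw [div_mul_eq_mul_div, div_le_div_iff₀ hd (by positivity), ← sub_nonneg]
    have hb : 0 ≤ 47 + 85 * p + 191 * p ^ 2 - 123 * p ^ 3 := by
      nlinarith [mul_nonneg (sq_nonneg p) hq]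
    -- The second summand of the bound suffices; it equals p / (4 - 3p) at p = 0 and p = 1, which
    -- explains the factors p and 1 - p.
    have : 0 ≤ p * (1 - p) * (47 + 85 * p + 191 * p ^ 2 - 123 * p ^ 3) :=
      mul_nonneg (mul_nonneg hp0 hq) hb
    linarith
  have h2 : 0 ≤ p * (1 - p) ^ 2 / (3 + p) := by positivity
  linarith

/-- A function of finitely many steps of the noise factors through a random variable with finitely
many values. -/
theorem exists_comp_of_dependsOn {Ω : Type*} (edge : ℕ → Ω → Edge 2) (recv : ℕ → Ω → Bool)
    (S : Finset ℕ) {f : (ℕ → Edge 2 × Bool) → ℝ}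
    (hf : DependsOn f (S : Set ℕ)) :
    ∃ g : (S → Edge 2 × Bool) → ℝ, ∀ ω,
      f (fun t => (edge t ω, recv t ω)) = g (fun t => (edge t ω, recv t ω)) := by
  obtain ⟨g, hg⟩ := dependsOn_iff_exists_comp.1 hf
  exact ⟨g, fun ω => congrFun hg _⟩

/-! ### Independence, almost sure convergence and the expected error -/

variable {Ω : Type*} [MeasurableSpace Ω] {P : Measure Ω} {p : ℝ}
  {edge : ℕ → Ω → Edge 2} {recv : ℕ → Ω → Bool}

theorem IsNoise.measurable_prod (h : IsNoise 2 p P edge recv) (t : ℕ) :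
    Measurable fun ω => (edge t ω, recv t ω) :=
  (h.measurable_edge t).prodMk (h.measurable_recv t)

theorem IsNoise.real_preimage (h : IsNoise 2 p P edge recv) (t : ℕ) (c : Edge 2 × Bool) :
    P.real ((fun ω => (edge t ω, recv t ω)) ⁻¹' {c}) = weight p c := by
  have := h.law t c.1 c.2
  rw [show {ω | edge t ω = c.1 ∧ recv t ω = c.2} = (fun ω => (edge t ω, recv t ω)) ⁻¹' {c} by
    ext ω; simp [Prod.ext_iff]] at this
  rw [this, weight]
  norm_num

theorem IsNoise.measurable_comp (h : IsNoise 2 p P edge recv) (S : Finset ℕ)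
    {f : (ℕ → Edge 2 × Bool) → ℝ} (hf : DependsOn f (S : Set ℕ)) :
    Measurable fun ω => f fun t => (edge t ω, recv t ω) := by
  obtain ⟨g, hg⟩ := exists_comp_of_dependsOn edge recv S hf
  simp only [hg]
  exact (Measurable.of_discrete (f := g)).comp
    (measurable_pi_lambda _ fun t => h.measurable_prod t)

/-- Integration over the outcome of one step, independent of later steps. -/
theorem IsNoise.integral_indicator_mul (h : IsNoise 2 p P edge recv) (s : ℕ) (S : Finset ℕ)
    (hs : s ∉ S) {f : (ℕ → Edge 2 × Bool) → ℝ} (hf : DependsOn f (S : Set ℕ))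
    (c : Edge 2 × Bool) :
    ∫ ω, (if (edge s ω, recv s ω) = c then 1 else 0) * f (fun t => (edge t ω, recv t ω)) ∂P =
      weight p c * ∫ ω, f (fun t => (edge t ω, recv t ω)) ∂P := by
  have hm := h.measurable_comp S hf
  obtain ⟨g, hg⟩ := exists_comp_of_dependsOn edge recv S hf
  have hind := h.indep.indepFun_finset {s} S (by simpa using hs) h.measurable_prod
  have hind' := hind.comp
    (φ := fun y => if y ⟨s, by simp⟩ = c then (1 : ℝ) else 0) (ψ := g)
    Measurable.of_discrete Measurable.of_discrete
  have hφ : Measurable fun ω => if (edge s ω, recv s ω) = c then (1 : ℝ) else 0 :=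
    (Measurable.of_discrete (f := fun d => if d = c then (1 : ℝ) else 0)).comp (h.measurable_prod s)
  simp only [hg] at hm ⊢
  refine (hind'.integral_mul_eq_mul_integral hφ.aestronglyMeasurable hm.aestronglyMeasurable).trans
    ?_
  congr 1
  rw [← h.real_preimage s c,
    ← integral_indicator_one (h.measurable_prod s (measurableSet_singleton c))]
  congr 1 with ω
  by_cases hc : (edge s ω, recv s ω) = c
  · exact (if_pos hc).trans (Set.indicator_of_mem (s := _ ⁻¹' {c}) hc 1).symm
  · exact (if_neg hc).trans (Set.indicator_of_notMem (s := _ ⁻¹' {c}) hc 1).symm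

variable [IsProbabilityMeasure P]

/-- Almost surely, the nodes successfully exchange messages infinitely often. -/
theorem IsNoise.frequently_exchange (h : IsNoise 2 p P edge recv) (hp1 : p < 1) :
    ∀ᵐ ω ∂P, ∃ᶠ t in atTop, (edge t ω, recv t ω) = (edge₀₁, true) ∧
      (edge (t + 1) ω, recv (t + 1) ω) = (edge₁₀, true) := by
  set X : ℕ → Ω → Edge 2 × Bool := fun t ω => (edge t ω, recv t ω) with hX
  let c : ℕ → Edge 2 × Bool := fun t => (if Even t then edge₀₁ else edge₁₀, true)
  -- Exchanges are sought only at times 2k, 2k + 1: disjoint time blocks make the events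
  -- independent, with constant probability ((1 - p)/2)².
  let A : ℕ → Set Ω := fun k => X (2 * k) ⁻¹' {c (2 * k)} ∩ X (2 * k + 1) ⁻¹' {c (2 * k + 1)}
  have hmeas : ∀ t, MeasurableSet (X t ⁻¹' {c t}) := fun t =>
    h.measurable_prod t (measurableSet_singleton _)
  have hprod : ∀ S : Finset ℕ, P (⋂ t ∈ S, X t ⁻¹' {c t}) = ∏ t ∈ S, P (X t ⁻¹' {c t}) :=
    fun S => h.indep.measure_inter_preimage_eq_mul S fun _ _ => measurableSet_singleton _
  have hA : ∀ S : Finset ℕ, P (⋂ k ∈ S, A k) =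
      ∏ k ∈ S, (P (X (2 * k) ⁻¹' {c (2 * k)}) * P (X (2 * k + 1) ⁻¹' {c (2 * k + 1)})) := by
    intro S
    have hdisj : (S : Set ℕ).PairwiseDisjoint fun k => ({2 * k, 2 * k + 1} : Finset ℕ) := by
      intro a _ b _ hab
      simp only [Function.onFun, Finset.disjoint_left, Finset.mem_insert, Finset.mem_singleton]
      omega
    rw [show (⋂ k ∈ S, A k) =
        ⋂ t ∈ S.biUnion fun k => ({2 * k, 2 * k + 1} : Finset ℕ), X t ⁻¹' {c t} by
      simp only [Finset.set_biInter_biUnion, Finset.set_biInter_insert,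
        Finset.set_biInter_singleton, A], hprod, Finset.prod_biUnion hdisj]
    exact Finset.prod_congr rfl fun k _ => Finset.prod_pair (by omega)
  have hAone : ∀ k, P (A k) =
      P (X (2 * k) ⁻¹' {c (2 * k)}) * P (X (2 * k + 1) ⁻¹' {c (2 * k + 1)}) := fun k => by
    simpa using hA {k}
  have hAm : ∀ k, MeasurableSet (A k) := fun k => (hmeas _).inter (hmeas _)
  have hind : iIndepSet A P := by
    rw [iIndepSet_iff_meas_biInter hAm]
    intro S
    rw [hA]
    exact Finset.prod_congr rfl fun k _ => (hAone k).symm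
  have hval : ∀ t, P (X t ⁻¹' {c t}) = ENNReal.ofReal ((1 - p) / 2) := fun t => by
    rw [← ofReal_measureReal, h.real_preimage]
    congr 1
    simp [weight, c]
    ring
  have hsum : ∑' k, P (A k) = ⊤ := by
    simp only [hAone, hval]
    refine ENNReal.tsum_const_eq_top_of_ne_zero ?_
    have : 0 < ENNReal.ofReal ((1 - p) / 2) := ENNReal.ofReal_pos.2 (by linarith)
    exact mul_ne_zero this.ne' this.ne'
  have hlim : ∀ᵐ ω ∂P, ω ∈ limsup A atTop := by
    exact (mem_ae_iff_prob_eq_one (MeasurableSet.measurableSet_limsup hAm)).2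
      (measure_limsup_eq_one hAm hind hsum)
  filter_upwards [hlim] with ω hω
  rw [mem_limsup_iff_frequently_mem] at hω
  have ht : Tendsto (fun k : ℕ => 2 * k) atTop atTop :=
    tendsto_atTop_mono (fun k => show k ≤ 2 * k by omega) tendsto_id
  refine ht.frequently (hω.mono ?_)
  rintro k ⟨h1, h2⟩
  simpa [X, c] using And.intro h1 h2

/-- Almost surely, the rescaled vectors of both nodes converge to the same limit. -/
theorem IsNoise.tendsto_ratio (h : IsNoise 2 p P edge recv) (hp1 : p < 1) :
    ∀ᵐ ω ∂P, ∀ i : Fin 2,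
      Tendsto (fun t => ratio edge recv i t ω) atTop (𝓝 (coeff edge recv ω)) := by
  filter_upwards [h.frequently_exchange hp1] with ω hω
  obtain ⟨l, hl⟩ := exists_tendsto_share (fun t => (edge t ω, recv t ω)) hω
  have key : ∀ i : Fin 2, Tendsto (fun t => ratio edge recv i t ω) atTop (𝓝 ![l, 1 - l]) := by
    intro i
    rw [tendsto_pi_nhds]
    intro j
    simp only [ratio_apply]
    fin_cases j
    · simpa using hl i
    · simpa using (hl i).const_sub 1
  intro i
  rw [coeff, (key 0).limUnder_eq]
  exact key i

theorem dependsOn_run (g : (Fin 2 → Fin 2 → ℝ) → ℝ) (s t : ℕ) :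
    DependsOn (fun x : ℕ → Edge 2 × Bool => g (run (fun k => x (k + s)) t))
      (Finset.Ico s (s + t) : Set ℕ) := by
  intro x y hxy
  simp only
  rw [run_congr fun k hk => hxy (k + s) (by simp; omega)]

/-- The expected squared bias is contracted by each additional step. -/
theorem IsNoise.integral_bias_sq_succ_le (h : IsNoise 2 p P edge recv) (hp0 : 0 ≤ p) (hp1 : p ≤ 1)
    (s t : ℕ) :
    ∫ ω, bias (run (fun k => (edge (k + s) ω, recv (k + s) ω)) (t + 1) 0) ^ 2 ∂P ≤
      (5 / 9 + p / 3) *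
        ∫ ω, bias (run (fun k => (edge (k + (s + 1)) ω, recv (k + (s + 1)) ω)) t 0) ^ 2 ∂P
      + p / 9 := by
  let r : Ω → Fin 2 → ℝ := fun ω =>
    run (fun k => (edge (k + (s + 1)) ω, recv (k + (s + 1)) ω)) t 0
  have hr0 : ∀ ω j, 0 ≤ r ω j := fun ω j => (pos_run _ t).nonneg 0 j
  have hact0 : ∀ c ω j, 0 ≤ act c (r ω) j := fun c ω j => by
    simp only [act]
    split_ifs <;> have := hr0 ω j <;> have := hr0 ω c.1.1.2 <;> linarith
  have hdep : ∀ g : (Fin 2 → ℝ) → ℝ, DependsOn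
      (fun x : ℕ → Edge 2 × Bool => g (run (fun k => x (k + (s + 1))) t 0)) _ :=
    fun g => dependsOn_run (fun z => g (z 0)) (s + 1) t
  have hmeas : ∀ g : (Fin 2 → ℝ) → ℝ, Measurable fun ω => g (r ω) :=
    fun g => h.measurable_comp _ (hdep g)
  have hint : ∀ g : (Fin 2 → ℝ) → ℝ, (∀ ω, g (r ω) ∈ Set.Icc (0 : ℝ) 1) →
      Integrable (fun ω => g (r ω)) P := fun g hg =>
    Integrable.of_mem_Icc 0 1 (hmeas g).aemeasurable (ae_of_all _ hg)
  have hb : ∀ v : Fin 2 → ℝ, (∀ j, 0 ≤ v j) → bias v ^ 2 ∈ Set.Icc (0 : ℝ) 1 :=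
    fun v hv => ⟨sq_nonneg _, bias_sq_le_one (hv 0) (hv 1)⟩
  have hia : ∀ c, Integrable (fun ω => bias (act c (r ω)) ^ 2) P := fun c =>
    hint (fun v => bias (act c v) ^ 2) fun ω => hb _ (hact0 c ω)
  have hir : Integrable (fun ω => bias (r ω) ^ 2) P :=
    hint (fun v => bias v ^ 2) fun ω => hb _ (hr0 ω)
  -- The row `r` uses only times from s + 1 on, so the outcome at time s is independent of it.
  have hsplit : ∀ ω, bias (run (fun k => (edge (k + s) ω, recv (k + s) ω)) (t + 1) 0) ^ 2 =
      ∑ c, (if (edge s ω, recv s ω) = c then 1 else 0) * bias (act c (r ω)) ^ 2 := by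
    intro ω
    rw [run_succ_eq_act]
    simp only [ite_mul, one_mul, zero_mul, Finset.sum_ite_eq, Finset.mem_univ, if_true, zero_add, r,
      add_assoc, add_comm 1 s]
  have hφ : ∀ c, Measurable fun ω => if (edge s ω, recv s ω) = c then (1 : ℝ) else 0 := fun c =>
    (Measurable.of_discrete (f := fun d => if d = c then (1 : ℝ) else 0)).comp (h.measurable_prod s)
  simp only [hsplit]
  rw [integral_finsetSum _ fun c _ => (hia c).bdd_mul (hφ c).aestronglyMeasurable (c := 1)
    (ae_of_all _ fun ω => by split_ifs <;> simp)]
  have hterm : ∀ c, ∫ ω, (if (edge s ω, recv s ω) = c then 1 else 0) *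
      bias (act c (r ω)) ^ 2 ∂P = ∫ ω, weight p c * bias (act c (r ω)) ^ 2 ∂P := fun c => by
    rw [integral_const_mul]
    exact h.integral_indicator_mul s _ (by simp) (hdep fun v => bias (act c v) ^ 2) c
  rw [Finset.sum_congr rfl fun c _ => hterm c,
    ← integral_finsetSum _ fun c _ => (hia c).const_mul _]
  calc ∫ ω, ∑ c, weight p c * bias (act c (r ω)) ^ 2 ∂P
      ≤ ∫ ω, ((5 / 9 + p / 3) * bias (r ω) ^ 2 + p / 9) ∂P :=
        integral_mono (integrable_finsetSum _ fun c _ => (hia c).const_mul _)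
          ((hir.const_mul _).add (integrable_const _)) fun ω =>
          sum_weight_mul_bias_act_sq_le hp0 hp1 (hr0 ω 0) (hr0 ω 1) ((pos_run _ t).pos 0)
    _ = _ := by
        rw [integral_add (hir.const_mul _) (integrable_const _), integral_const_mul]
        simp [r]

/-- The shift s is kept general because peeling off the first step moves the start to s + 1. -/
theorem IsNoise.integral_bias_sq_le (h : IsNoise 2 p P edge recv) (hp0 : 0 ≤ p) (hp1 : p < 1)
    (s t : ℕ) :
    ∫ ω, bias (run (fun k => (edge (k + s) ω, recv (k + s) ω)) t 0) ^ 2 ∂P ≤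
      (5 / 9 + p / 3) ^ t + p / (4 - 3 * p) := by
  have hd : 0 < 4 - 3 * p := by linarith
  induction t generalizing s with
  | zero =>
    -- The initial vector (1, 0) has bias 1, matched by the zeroth power.
    have : 0 ≤ p / (4 - 3 * p) := by positivity
    simpa [run, bias] using this
  | succ t ih =>
    refine (h.integral_bias_sq_succ_le hp0 hp1.le s t).trans ?_
    have := mul_le_mul_of_nonneg_left (ih (s + 1)) (show 0 ≤ 5 / 9 + p / 3 by positivity)
    have hfix : (5 / 9 + p / 3) * (p / (4 - 3 * p)) + p / 9 = p / (4 - 3 * p) := by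
      rw [mul_div_assoc', div_add' _ _ _ hd.ne']
      congr 1
      ring
    rw [pow_succ']
    linarith

theorem continuous_sqError {n : ℕ} : Continuous (sqError (n := n)) := by
  unfold sqError
  fun_prop

theorem IsNoise.integrable_and_integral_sqError_le (h : IsNoise 2 p P edge recv) (hp0 : 0 ≤ p)
    (hp1 : p < 1) :
    Integrable (fun ω => sqError (coeff edge recv ω)) P ∧
      ∫ ω, sqError (coeff edge recv ω) ∂P ≤ p / (4 - 3 * p) := by
  let F : ℕ → Ω → ℝ := fun t ω => bias (run (fun k => (edge k ω, recv k ω)) t 0) ^ 2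
  have hF : ∀ t ω, F t ω ∈ Set.Icc (0 : ℝ) 1 := fun t ω =>
    ⟨sq_nonneg _, bias_sq_le_one ((pos_run _ t).nonneg 0 0) ((pos_run _ t).nonneg 0 1)⟩
  have hmeas : ∀ t, Measurable (F t) := fun t =>
    h.measurable_comp _ (dependsOn_run (fun z => bias (z 0) ^ 2) 0 t)
  have hlim : ∀ᵐ ω ∂P, Tendsto (fun t => F t ω) atTop (𝓝 (sqError (coeff edge recv ω))) := by
    filter_upwards [h.tendsto_ratio hp1] with ω hω
    simp only [F, ← sqError_ratio]
    exact (continuous_sqError.tendsto _).comp (hω 0)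
  have hint : Integrable (fun ω => sqError (coeff edge recv ω)) P := by
    refine Integrable.of_mem_Icc 0 1
      (aemeasurable_of_tendsto_metrizable_ae' (fun t => (hmeas t).aemeasurable) hlim) ?_
    filter_upwards [hlim] with ω hω
    exact isClosed_Icc.mem_of_tendsto hω (Eventually.of_forall fun t => hF t ω)
  refine ⟨hint, ?_⟩
  -- Squared biases are at most 1, so the constant 1 dominates.
  have hI := tendsto_integral_of_dominated_convergence (fun _ => 1)
    (fun t => (hmeas t).aestronglyMeasurable) (integrable_const _)
    (fun t => ae_of_all _ fun ω => by
      rw [Real.norm_of_nonneg (hF t ω).1]; exact (hF t ω).2) hlim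
  have hpow : Tendsto (fun t : ℕ => (5 / 9 + p / 3) ^ t + p / (4 - 3 * p)) atTop
      (𝓝 (0 + p / (4 - 3 * p))) :=
    (tendsto_pow_atTop_nhds_zero_of_lt_one (by positivity) (by linarith)).add_const _
  rw [zero_add] at hpow
  exact le_of_tendsto_of_tendsto' hI hpow fun t => h.integral_bias_sq_le hp0 hp1 0 t

end PushSum

theorem theorem4 {Ω : Type*} [MeasurableSpace Ω] (P : Measure Ω) [IsProbabilityMeasure P]
    (p : ℝ) (hp0 : 0 ≤ p) (hp1 : p < 1)
    (edge : ℕ → Ω → PushSum.Edge 2) (recv : ℕ → Ω → Bool)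
    (hnoise : PushSum.IsNoise 2 p P edge recv) :
    (∀ᵐ ω ∂P, ∀ i : Fin 2,
      Tendsto (fun t => PushSum.ratio edge recv i t ω) atTop (𝓝 (PushSum.coeff edge recv ω))) ∧
    Integrable (fun ω => PushSum.sqError (PushSum.coeff edge recv ω)) P ∧
    PushSum.expectedError P edge recv ≤
      p * (1 - p) ^ 2 / (3 + p)
        + p / (25 * (1 + p ^ 2)) * (18 + 23 * p + 50 * p ^ 2 - 41 * p ^ 3) :=
  have h := hnoise.integrable_and_integral_sqError_le hp0 hp1
  ⟨hnoise.tendsto_ratio hp1, h.1, h.2.trans (PushSum.fixed_point_le hp0 hp1.le)⟩
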